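/- Identify the unit circle $\mathbb S$ with $\mathbb R/\mathbb Z$ and let $\sigma_3(t)=3t \pmod 1$. A chord of the closed unit disk $\overline{\mathbb D}$ with endpoints $a,b\in\mathbb S$ (possibly $a=b$, a degenerate chord) is written $\overline{ab}$, and $\sigma_3(\overline{ab})$ denotes the chord $\overline{\sigma_3(a)\sigma_3(b)}$. A lamination is a collection $\mathcal L$ of chords, called leaves, such that any two distinct leaves meet, if at all, in a point of $\mathbb S$, and such that $\mathcal L^*=\mathbb S\cup\bigcup\mathcal L$ is closed. It is sibling $3$-invariant if (1) $\sigma_3(\ell)\in\mathcal L$ for every $\ell\in\mathcal L$; (2) every non-degenerate $\ell'\in\mathcal L$ equals $\sigma_3(\ell)$ for some $\ell\in\mathcal L$; and (3) every $\ell_1\in\mathcal L$ for which $\sigma_3(\ell_1)$ is non-degenerate belongs to a collection of three pairwise disjoint leaves $\ell_1,\ell_2,\ell_3\in\mathcal L$ with $\sigma_3(\ell_1)=\sigma_3(\ell_2)=\sigma_3(\ell_3)$. A gap of $\mathcal L$ is the closure of a connected component of $\overline{\mathbb D}\setminus\mathcal L^*$; a polygon of $\mathcal L$ is a gap that is the convex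 hull of a finite set of points of $\mathbb S$, its vertices. For a polygon $P$ with vertex set $V$, let $\sigma_3^i(P)$ be the convex hull of $\sigma_3^i(V)$. The polygon $P$ is an identity return polygon if for some $n\ge 1$ the sets $P,\sigma_3(P),\dots,\sigma_3^{n-1}(P)$ are pairwise disjoint and $\sigma_3^n(v)=v$ for every vertex $v\in V$. **Theorem.** No sibling $3$-invariant lamination has an identity return polygon with exactly four vertices (an identity return quadrilateral). -/

import Mathlib

namespace Lamination

/-- The unit circle, parameterized as `ℝ / ℤ`. -/
abbrev S : Type := UnitAddCircle

/-- The point `exp (2 π i x)` of the complex plane with parameter `x ∈ ℝ / ℤ`. -/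
noncomputable def pt (x : S) : ℂ := (AddCircle.toCircle x : ℂ)

/-- The map `σ_d(t) = d t (mod 1)` of the circle. -/
def sigma (d : ℕ) (x : S) : S := d • x

/-- The convex hull, in the closed unit disk, of a set of points of the circle. -/
noncomputable def hull (V : Set S) : Set ℂ := convexHull ℝ (pt '' V)

/-- The (possibly degenerate) closed chord with the given unordered pair of endpoints. -/
noncomputable def chord (l : Sym2 S) : Set ℂ := hull {x | x ∈ l}

/-- The action of `σ_d` on chords: the chord `ab` goes to the chord `σ_d(a) σ_d(b)`. -/
def sigmaChord (d : ℕ) (l : Sym2 S) : Sym2 S := l.map (sigma d)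

/-- The set `L^* = S ∪ ⋃ L`. -/
def star (L : Set (Sym2 S)) : Set ℂ := Metric.sphere 0 1 ∪ ⋃ l ∈ L, chord l

/-- A lamination: a collection of chords (leaves, degenerate ones allowed), any two of which meet,
if at all, in a point of the circle, and such that `L^*` is closed. -/
structure IsLamination (L : Set (Sym2 S)) : Prop where
  meet : ∀ l ∈ L, ∀ m ∈ L, l ≠ m → chord l ∩ chord m ⊆ Metric.sphere 0 1
  closed : IsClosed (star L)

/-- Sibling `d`-invariant laminations. A chord is degenerate iff its two endpoints agree
(`Sym2.IsDiag`); leaves are disjoint if they are disjoint as closed chords. -/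
structure IsSiblingInvariant (d : ℕ) (L : Set (Sym2 S)) : Prop extends IsLamination L where
  forward : ∀ l ∈ L, sigmaChord d l ∈ L
  backward : ∀ l' ∈ L, ¬ l'.IsDiag → ∃ l ∈ L, sigmaChord d l = l'
  sibling : ∀ l ∈ L, ¬ (sigmaChord d l).IsDiag →
    ∃ f : Fin d → Sym2 S,
      (∃ i, f i = l) ∧
      (∀ i, f i ∈ L ∧ sigmaChord d (f i) = sigmaChord d l) ∧
      (∀ i j, i ≠ j → Disjoint (chord (f i)) (chord (f j)))

/-- A gap of `L`: the closure of a connected component of the closed disk minus `L^*`. -/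
def IsGap (L : Set (Sym2 S)) (G : Set ℂ) : Prop :=
  ∃ z ∈ Metric.closedBall (0 : ℂ) 1 \ star L,
    G = closure (connectedComponentIn (Metric.closedBall (0 : ℂ) 1 \ star L) z)

/-- The finite set `V` of points of the circle is the vertex set of a polygon of `L`,
i.e. of a finite gap of `L`. -/
def IsPolygon (L : Set (Sym2 S)) (V : Finset S) : Prop := IsGap L (hull V)

/-- The polygon with vertex set `V` is an identity return polygon of the lamination `L` for `σ_d`:
for some `n ≥ 1` the polygons `P, σ_d(P), …, σ_d^{n-1}(P)` are pairwise disjoint (so that `P`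
returns to itself at time `n` at the earliest), and `σ_d^n` fixes every vertex of `P`. -/
def IsIdentityReturnPolygon (d : ℕ) (L : Set (Sym2 S)) (V : Finset S) : Prop :=
  IsPolygon L V ∧
    ∃ n : ℕ, 0 < n ∧
      (∀ i < n, ∀ j < n, i ≠ j →
        Disjoint (hull ((sigma d)^[i] '' (V : Set S))) (hull ((sigma d)^[j] '' (V : Set S)))) ∧
      (∀ v ∈ V, (sigma d)^[n] v = v)

end Lamination

/-! Call the arc between consecutive vertices of a quadrilateral in the orbit of `P` a sector. The
edges of `P` are leaves (`IsLamination.leaf_of_isGap`), hence so are those of its images, and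
counting sibling leaves shows that `σ₃` keeps the cyclic order of the vertices
(`IsSiblingInvariant.cyc_sigma`). The sectors therefore form four cycles under `σ₃`.

The predecessor of a shortest sector in its cycle must wrap around the circle: otherwise it would be
three times shorter still. A sector that contains another quadrilateral is longer than three of that
quadrilateral's sectors, so in at least three cycles the shortest sector has no vertex in its
interior (`IsQuadCycle.exists_critical`).

The edges below these three long predecessors behave like non-crossing critical chords of `σ₃` over
three different points, while a cubic map admits only two. `IsQuadCycle.exists_mod_eq` expresses
non-crossing as a congruence modulo 3, and `IsQuadCycle.false` shows that three such congruences are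
incompatible. -/

namespace Lamination

/-! ### Arc lengths and cyclic order on the circle. -/

/-- The length in `[0, 1)` of the positively oriented arc from `a` to `b`. -/
noncomputable def len (a b : S) : ℝ := (AddCircle.equivIco 1 0 (b - a) : ℝ)

lemma len_nonneg (a b : S) : 0 ≤ len a b := (AddCircle.equivIco 1 0 (b - a)).2.1

lemma len_lt_one (a b : S) : len a b < 1 := by
  have := (AddCircle.equivIco (1 : ℝ) 0 (b - a)).2.2
  simpa [len] using this

lemma coe_len (a b : S) : ((len a b : ℝ) : S) = b - a := AddCircle.coe_equivIco

lemma exists_int_of_coe_eq {s t : ℝ} (h : (s : S) = (t : S)) : ∃ z : ℤ, s = t + z := by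
  rw [← sub_eq_zero, ← AddCircle.coe_sub, AddCircle.coe_eq_zero_iff] at h
  obtain ⟨z, hz⟩ := h
  exact ⟨z, by simp at hz; linarith⟩

lemma len_self (a : S) : len a a = 0 := by
  obtain ⟨z, hz⟩ := exists_int_of_coe_eq (s := len a a) (t := 0) (by simp [coe_len])
  have h0 := len_nonneg a a
  have h1 := len_lt_one a a
  have : z = 0 := by
    have h2 : (-1 : ℝ) < z := by linarith
    have h3 : (z : ℝ) < 1 := by linarith
    norm_cast at h2 h3
    omega
  simp [hz, this]

lemma eq_of_len_eq {a b c : S} (h : len a b = len a c) : b = c := by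
  have := coe_len a b
  rw [h, coe_len] at this
  exact (sub_left_injective this).symm

lemma len_pos {a b : S} (h : a ≠ b) : 0 < len a b :=
  lt_of_le_of_ne (len_nonneg a b) fun h0 => h (eq_of_len_eq (a := a) (by rw [len_self, h0]))

lemma len_triangle (a b c : S) :
    len a c = len a b + len b c ∨ len a c = len a b + len b c - 1 := by
  obtain ⟨z, hz⟩ := exists_int_of_coe_eq (s := len a c) (t := len a b + len b c)
    (by rw [AddCircle.coe_add, coe_len, coe_len, coe_len]; abel)
  have h1 := len_nonneg a b
  have h2 := len_lt_one a b
  have h3 := len_nonneg b c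
  have h4 := len_lt_one b c
  have h5 := len_nonneg a c
  have h6 := len_lt_one a c
  have h7 : (-2 : ℝ) < z := by linarith
  have h8 : (z : ℝ) < 1 := by linarith
  norm_cast at h7 h8
  obtain rfl | rfl : z = 0 ∨ z = -1 := by omega
  · left; simpa using hz
  · right; rw [hz]; push_cast; ring

lemma len_add_len {a b : S} (h : a ≠ b) : len a b + len b a = 1 := by
  have h1 := len_pos h
  have h2 := len_nonneg b a
  have h3 := len_self a
  rcases len_triangle a b a with h4 | h4 <;> linarith

/-- The number `w` counts the full turns made by the image of the arc; all later counting rests on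
it. -/
lemma three_mul_len (a b : S) :
    ∃ w : ℕ, w < 3 ∧ 3 * len a b = len (sigma 3 a) (sigma 3 b) + w := by
  obtain ⟨z, hz⟩ := exists_int_of_coe_eq (s := 3 * len a b) (t := len (sigma 3 a) (sigma 3 b))
    (by
      rw [coe_len, sigma, sigma, ← smul_sub, ← coe_len, ← AddCircle.coe_nsmul]
      simp)
  have h1 := len_nonneg a b
  have h2 := len_lt_one a b
  have h3 := len_nonneg (sigma 3 a) (sigma 3 b)
  have h4 := len_lt_one (sigma 3 a) (sigma 3 b)
  have h7 : (-1 : ℝ) < z := by linarith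
  have h8 : (z : ℝ) < 3 := by linarith
  norm_cast at h7 h8
  lift z to ℕ using by omega
  exact ⟨z, by omega, by simpa using hz⟩

/-- Four points in strict positive cyclic order. -/
def Cyc (a b c d : S) : Prop := 0 < len a b ∧ len a b < len a c ∧ len a c < len a d

lemma cyc_of_lt {o a b c d : S} (h1 : len o a < len o b) (h2 : len o b < len o c)
    (h3 : len o c < len o d) : Cyc a b c d := by
  have := len_nonneg o a
  have := len_lt_one o d
  have := len_nonneg a b
  have := len_nonneg a c
  have := len_nonneg a d
  have := len_lt_one a b
  have := len_lt_one a c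
  have := len_lt_one a d
  refine ⟨?_, ?_, ?_⟩ <;>
  rcases len_triangle o a b with h4 | h4 <;> rcases len_triangle o a c with h5 | h5 <;>
  rcases len_triangle o a d with h6 | h6 <;> linarith

lemma Cyc.rotate {a b c d : S} (h : Cyc a b c d) : Cyc b c d a := by
  obtain ⟨h1, h2, h3⟩ := h
  have hab : a ≠ b := by rintro rfl; simp [len_self] at h1
  have := len_add_len hab
  have := len_lt_one a d
  have := len_nonneg b c
  have := len_nonneg b d
  have := len_lt_one b c
  have := len_lt_one b d
  refine ⟨?_, ?_, ?_⟩ <;>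
  rcases len_triangle a b c with h4 | h4 <;> rcases len_triangle a b d with h5 | h5 <;> linarith

lemma Cyc.sum_eq {a b c d : S} (h : Cyc a b c d) :
    len a b + len b c + len c d + len d a = 1 := by
  have h' := h.rotate
  obtain ⟨h1, h2, h3⟩ := h
  obtain ⟨h4, h5, h6⟩ := h'
  have had : a ≠ d := by rintro rfl; simp [len_self] at h3; linarith
  have := len_add_len had
  have := len_lt_one a d
  have := len_nonneg c d
  have := len_lt_one c d
  have := len_lt_one b c
  rcases len_triangle a b c with h7 | h7 <;> rcases len_triangle a c d with h8 | h8 <;> linarith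

/-- Points on which each arc between cyclically consecutive ones contains no other are cyclically
ordered. -/
lemma cyc_of_le {a b c d : S} (hab : a ≠ b) (hbc : b ≠ c) (hcd : c ≠ d)
    (h1 : len a b ≤ len a c) (h2 : len a b ≤ len a d) (h3 : len b c ≤ len b d) : Cyc a b c d := by
  have e1 : len a b ≠ len a c := fun h => hbc (eq_of_len_eq h)
  have e2 : len a c ≠ len a d := fun h => hcd (eq_of_len_eq h)
  have := len_pos hab
  have := len_lt_one a d
  have := len_lt_one a c
  have := len_nonneg b c
  have := len_nonneg b d
  have := len_lt_one b c
  have := len_lt_one b d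
  refine ⟨len_pos hab, lt_of_le_of_ne h1 e1, lt_of_le_of_ne ?_ e2⟩
  rcases len_triangle a b c with h4 | h4 <;> rcases len_triangle a b d with h5 | h5 <;> linarith

lemma exists_cyc {V : Finset S} (hV : V.card = 4) :
    ∃ v : Fin 4 → S, (∀ j, v j ∈ V) ∧ (∀ x ∈ V, ∃ j, v j = x) ∧
      Function.Injective v ∧ Cyc (v 0) (v 1) (v 2) (v 3) := by
  have hinj : Function.Injective (len 0) := fun x y h => eq_of_len_eq h
  have hc : (V.image (len 0)).card = 4 := by rw [Finset.card_image_of_injective _ hinj, hV]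
  let e := (V.image (len 0)).orderEmbOfFin hc
  have he : ∀ j, ∃ x ∈ V, len 0 x = e j := fun j => by
    exact Finset.mem_image.1 (Finset.orderEmbOfFin_mem (V.image (len 0)) hc j)
  choose v hv hve using he
  refine ⟨v, hv, fun x hx => ?_, fun i j hij => e.injective ?_, ?_⟩
  · have : len 0 x ∈ Set.range e := by
      rw [Finset.range_orderEmbOfFin]
      simpa using ⟨x, hx, rfl⟩
    obtain ⟨j, hj⟩ := this
    exact ⟨j, hinj (by rw [hve, hj])⟩
  · rw [← hve, ← hve, hij]
  · apply cyc_of_lt (o := 0) <;> rw [hve, hve] <;> exact e.strictMono (by decide)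

/-! ### Chords and sides of lines in the disk. -/

/-- Twice the signed area of the triangle `A`, `B`, `z`: its sign tells on which side of the
line `AB` the point `z` lies. -/
noncomputable def side (A B z : ℂ) : ℝ :=
  (B.re - A.re) * (z.im - A.im) - (B.im - A.im) * (z.re - A.re)

lemma continuous_side (A B : ℂ) : Continuous (side A B) := by
  unfold side; fun_prop

lemma side_comb (A B z w : ℂ) {s t : ℝ} (h : s + t = 1) :
    side A B (s • z + t • w) = s * side A B z + t * side A B w := by
  obtain rfl : s = 1 - t := by linarith
  simp [side]; ring

lemma normSq_pt (x : S) : (pt x).re ^ 2 + (pt x).im ^ 2 = 1 := by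
  have : Complex.normSq (pt x) = 1 := by simp [pt]
  rw [← this, Complex.normSq_apply]; ring

lemma pt_injective : Function.Injective pt := fun _ _ h =>
  AddCircle.injective_toCircle one_ne_zero (Subtype.ext h)

lemma norm_lt_one_iff (z : ℂ) : ‖z‖ < 1 ↔ z.re ^ 2 + z.im ^ 2 < 1 := by
  rw [← sq_lt_one_iff₀ (norm_nonneg z), ← Complex.normSq_eq_norm_sq, Complex.normSq_apply]
  ring_nf

lemma chord_mk (a b : S) : chord s(a, b) = segment ℝ (pt a) (pt b) := by
  have : {x | x ∈ s(a, b)} = ({a, b} : Set S) := by ext; simp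
  rw [chord, hull, this, Set.image_pair, convexHull_pair]

lemma pt_mul (a b : S) : pt b = pt a *
    ⟨Real.cos (2 * (Real.pi * len a b)), Real.sin (2 * (Real.pi * len a b))⟩ := by
  have h : b = a + (len a b : ℝ) := by rw [coe_len]; abel
  conv_lhs => rw [h]
  rw [pt, AddCircle.toCircle_add, Circle.coe_mul, AddCircle.toCircle_apply_mk, Circle.coe_exp, pt]
  congr 1
  apply Complex.ext
  · rw [Complex.exp_ofReal_mul_I_re]; ring_nf
  · rw [Complex.exp_ofReal_mul_I_im]; ring_nf

/-- Rotating `a` to 1 and halving angles turns the area into a product of sines, so its sign can be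
read off from the order of the arc lengths. -/
lemma side_pt (a b c : S) : side (pt a) (pt b) (pt c) =
    4 * Real.sin (Real.pi * len a b) * Real.sin (Real.pi * len a c) *
      Real.sin (Real.pi * len a c - Real.pi * len a b) := by
  have h := normSq_pt a
  rw [pt_mul a b, pt_mul a c, side]
  generalize Real.pi * len a b = β
  generalize Real.pi * len a c = γ
  rw [Real.sin_sub]
  simp only [Complex.mul_re, Complex.mul_im, Real.cos_two_mul, Real.sin_two_mul]
  generalize (pt a).re = x at *
  generalize (pt a).im = y at *
  have hβ := Real.sin_sq_add_cos_sq β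
  have hγ := Real.sin_sq_add_cos_sq γ
  generalize Real.sin β = p at *
  generalize Real.cos β = q at *
  generalize Real.sin γ = r at *
  generalize Real.cos γ = u at *
  have e : q ^ 2 = 1 - p ^ 2 := by linarith
  have e' : u ^ 2 = 1 - r ^ 2 := by linarith
  rw [e, e']
  linear_combination (4 * p * r * (r * q - p * u)) * h

lemma side_pos {a b c : S} (h0 : 0 < len a b) (h : len a b < len a c) :
    0 < side (pt a) (pt b) (pt c) := by
  have h1 := len_lt_one a c
  have hpi := Real.pi_pos
  rw [side_pt]
  have := Real.sin_pos_of_pos_of_lt_pi (x := Real.pi * len a b) (by positivity) (by nlinarith)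
  have := Real.sin_pos_of_pos_of_lt_pi (x := Real.pi * len a c)
    (mul_pos hpi (h0.trans h)) (by nlinarith)
  have := Real.sin_pos_of_pos_of_lt_pi (x := Real.pi * len a c - Real.pi * len a b)
    (by nlinarith) (by nlinarith)
  positivity

lemma side_neg {a b c : S} (h0 : 0 < len a c) (h : len a c < len a b) :
    side (pt a) (pt b) (pt c) < 0 := by
  have h1 := len_lt_one a b
  have hpi := Real.pi_pos
  rw [side_pt, ← neg_sub (Real.pi * len a b), Real.sin_neg]
  have := Real.sin_pos_of_pos_of_lt_pi (x := Real.pi * len a b)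
    (mul_pos hpi (h0.trans h)) (by nlinarith)
  have := Real.sin_pos_of_pos_of_lt_pi (x := Real.pi * len a c) (by positivity) (by nlinarith)
  have := Real.sin_pos_of_pos_of_lt_pi (x := Real.pi * len a b - Real.pi * len a c)
    (by nlinarith) (by nlinarith)
  rw [mul_neg, neg_lt_zero]
  positivity

lemma side_left (A B : ℂ) : side A B A = 0 := by simp [side]

lemma side_right (A B : ℂ) : side A B B = 0 := by simp [side]; ring

lemma sq_add_sq_pos {A B : ℂ} (hAB : A ≠ B) : 0 < (B.re - A.re) ^ 2 + (B.im - A.im) ^ 2 := by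
  by_contra! h0
  apply hAB
  apply Complex.ext <;> nlinarith [sq_nonneg (B.re - A.re), sq_nonneg (B.im - A.im)]

lemma exists_of_side_eq_zero {A B z : ℂ} (hAB : A ≠ B) (h : side A B z = 0) :
    ∃ s : ℝ, z = (1 - s) • A + s • B := by
  have hn := (sq_add_sq_pos hAB).ne'
  obtain ⟨s, hs⟩ : ∃ s : ℝ, s * ((B.re - A.re) ^ 2 + (B.im - A.im) ^ 2) =
      (B.re - A.re) * (z.re - A.re) + (B.im - A.im) * (z.im - A.im) :=
    ⟨_, div_mul_cancel₀ _ hn⟩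
  refine ⟨s, ?_⟩
  unfold side at h
  apply Complex.ext <;> simp <;> apply mul_right_cancel₀ hn
  · linear_combination (-(B.im - A.im)) * h - (B.re - A.re) * hs
  · linear_combination (B.re - A.re) * h - (B.im - A.im) * hs

/-- Power of a point: it separates the parameters inside the open disk from the others. -/
lemma normSq_comb (a b : S) (s : ℝ) :
    ((1 - s) • pt a + s • pt b).re ^ 2 + ((1 - s) • pt a + s • pt b).im ^ 2 =
      1 - s * (1 - s) * (((pt b).re - (pt a).re) ^ 2 + ((pt b).im - (pt a).im) ^ 2) := by
  have ha := normSq_pt a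
  have hb := normSq_pt b
  simp
  linear_combination (1 - s) * ha + s * hb

lemma mem_chord_of_side_eq_zero {a b : S} (hab : a ≠ b) {z : ℂ} (hz : ‖z‖ < 1)
    (h : side (pt a) (pt b) z = 0) : z ∈ chord s(a, b) := by
  obtain ⟨s, rfl⟩ := exists_of_side_eq_zero (pt_injective.ne hab) h
  rw [norm_lt_one_iff, normSq_comb] at hz
  have h1 : 0 < s * (1 - s) := by
    by_contra! h2
    nlinarith [sq_nonneg ((pt b).re - (pt a).re), sq_nonneg ((pt b).im - (pt a).im)]
  rw [chord_mk]
  exact ⟨1 - s, s, by nlinarith, by nlinarith, by ring, rfl⟩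

lemma side_eq_zero_of_mem_chord {a b : S} {z : ℂ} (h : z ∈ chord s(a, b)) :
    side (pt a) (pt b) z = 0 := by
  rw [chord_mk] at h
  obtain ⟨s, t, -, -, hst, rfl⟩ := h
  rw [side_comb _ _ _ _ hst, side_left, side_right]; ring

lemma norm_comb_lt {a b : S} (hab : a ≠ b) {s : ℝ} (h0 : 0 < s) (h1 : s < 1) :
    ‖(1 - s) • pt a + s • pt b‖ < 1 := by
  rw [norm_lt_one_iff, normSq_comb]
  have := sq_add_sq_pos (pt_injective.ne hab)
  have := mul_pos (mul_pos h0 (sub_pos.2 h1)) this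
  linarith

lemma eq_or_eq_of_side_eq_zero {a b c : S} (hab : a ≠ b)
    (h : side (pt a) (pt b) (pt c) = 0) : c = a ∨ c = b := by
  by_contra! hc
  have h1 := len_pos hab
  have h2 := len_pos hc.1.symm
  rcases lt_trichotomy (len a b) (len a c) with h3 | h3 | h3
  · exact (side_pos h1 h3).ne' h
  · exact hc.2 (eq_of_len_eq h3).symm
  · exact (side_neg h2 h3).ne h

/-! ### Leaves do not cross, and edges of polygons are leaves. -/

lemma IsLamination.not_cross {L : Set (Sym2 S)} (hL : IsLamination L) {a b c d : S}
    (hab : s(a, b) ∈ L) (hcd : s(c, d) ∈ L) (h0 : 0 < len a c) (h1 : len a c < len a b) :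
    len a d ≤ len a b := by
  by_contra! h2
  have hne : a ≠ b := by rintro rfl; rw [len_self] at h1; linarith
  have hcd' : c ≠ d := by rintro rfl; linarith
  have hc := side_neg h0 h1
  have hd := side_pos (h0.trans h1) h2
  set f := side (pt a) (pt b)
  -- The zero of the affine function `f` along `cd`, that is, the crossing point with the line `ab`.
  set s := -f (pt c) / (f (pt d) - f (pt c))
  have hpos : 0 < f (pt d) - f (pt c) := by linarith
  have hs0 : 0 < s := div_pos (by linarith) hpos
  have hs1 : s < 1 := (div_lt_one hpos).2 (by linarith)
  have hz1 := norm_comb_lt hcd' hs0 hs1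
  have hz2 : f ((1 - s) • pt c + s • pt d) = 0 := by
    have h3 : s * (f (pt d) - f (pt c)) = -f (pt c) := div_mul_cancel₀ _ hpos.ne'
    have h4 := side_comb (pt a) (pt b) (pt c) (pt d) (sub_add_cancel 1 s)
    change f _ = (1 - s) * f _ + s * f _ at h4
    linarith
  have hz3 := mem_chord_of_side_eq_zero hne hz1 hz2
  have hz4 : (1 - s) • pt c + s • pt d ∈ chord s(c, d) := by
    rw [chord_mk]; exact ⟨1 - s, s, by linarith, by linarith, by ring, rfl⟩
  have hne' : s(a, b) ≠ s(c, d) := by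
    intro h
    have : c ∈ s(a, b) := h ▸ Sym2.mem_mk_left c d
    rcases Sym2.mem_iff.1 this with rfl | rfl
    · rw [len_self] at h0; linarith
    · linarith
  have := hL.meet _ hab _ hcd hne' ⟨hz3, hz4⟩
  rw [mem_sphere_zero_iff_norm] at this
  linarith

lemma IsLamination.isOpen_compl {L : Set (Sym2 S)} (hL : IsLamination L) :
    IsOpen (Metric.closedBall (0 : ℂ) 1 \ star L) := by
  have : Metric.closedBall (0 : ℂ) 1 \ star L = Metric.ball 0 1 \ star L := by
    ext z
    simp only [Set.mem_sdiff, mem_closedBall_zero_iff, mem_ball_zero_iff, and_congr_left_iff]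
    intro h
    refine ⟨fun h1 => lt_of_le_of_ne h1 fun h2 => h (Or.inl (by simpa using h2)), le_of_lt⟩
  rw [this]
  exact Metric.isOpen_ball.sdiff hL.closed

/-- The gap lies on one side of `ab`, so the midpoint of this chord is a boundary point of the
component and lies on some leaf `cd`. The component is connected and misses `cd`, so `a` and `b` are
weakly on one side of `cd`; as their midpoint is on that line, both are. -/
lemma IsLamination.leaf_of_isGap {L : Set (Sym2 S)} (hL : IsLamination L) {V : Finset S}
    (hV : IsPolygon L V) {a b : S} (ha : a ∈ V) (hb : b ∈ V) (hab : a ≠ b)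
    (h : ∀ v ∈ V, v = a ∨ len a b ≤ len a v) : s(a, b) ∈ L := by
  obtain ⟨z₀, hz₀, hG⟩ := hV
  set W := Metric.closedBall (0 : ℂ) 1 \ star L with hW
  set U := connectedComponentIn W z₀ with hU
  have hWo : IsOpen W := hL.isOpen_compl
  have hUo : IsOpen U := hWo.connectedComponentIn
  have hAmem : pt a ∈ closure U := hG ▸ subset_convexHull ℝ _ ⟨a, ha, rfl⟩
  have hBmem : pt b ∈ closure U := hG ▸ subset_convexHull ℝ _ ⟨b, hb, rfl⟩
  set z : ℂ := (1 - (1 / 2 : ℝ)) • pt a + (1 / 2 : ℝ) • pt b with hz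
  have hzlt : ‖z‖ < 1 := norm_comb_lt hab (by norm_num) (by norm_num)
  have hzmem : z ∈ closure U := by
    rw [← hG]
    have ha' : pt a ∈ hull (V : Set S) := subset_convexHull ℝ _ ⟨a, ha, rfl⟩
    have hb' : pt b ∈ hull (V : Set S) := subset_convexHull ℝ _ ⟨b, hb, rfl⟩
    exact convex_convexHull ℝ _ ha' hb' (by norm_num) (by norm_num) (by norm_num)
  have hside : ∀ y ∈ U, 0 ≤ side (pt a) (pt b) y := by
    have hconv : Convex ℝ {y | 0 ≤ side (pt a) (pt b) y} := by
      intro x hx y hy s t hs ht hst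
      simp only [Set.mem_ofPred_eq] at *
      rw [side_comb _ _ _ _ hst]
      positivity
    have hsub : hull (V : Set S) ⊆ {y | 0 ≤ side (pt a) (pt b) y} := by
      refine convexHull_min ?_ hconv
      rintro _ ⟨v, hv, rfl⟩
      rcases h v hv with rfl | h1
      · exact (side_left _ _).ge
      · rcases h1.eq_or_lt with h2 | h2
        · rw [← eq_of_len_eq h2]; exact (side_right _ _).ge
        · exact (side_pos (len_pos hab) h2).le
    exact fun y hy => hsub (hG ▸ subset_closure hy)
  have hsz : side (pt a) (pt b) z = 0 := by
    rw [hz, side_comb _ _ _ _ (by ring), side_left, side_right]; ring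
  have hzU : z ∉ U := by
    intro hzU
    -- Were the midpoint in the open set `U`, a small push along the normal would leave the
    -- half-plane of `hside`.
    have hcont : ContinuousAt (fun t : ℝ => z - (t : ℂ) * (Complex.I * (pt b - pt a))) 0 := by
      fun_prop
    have hnear : ∀ᶠ t : ℝ in nhds 0, z - (t : ℂ) * (Complex.I * (pt b - pt a)) ∈ U :=
      hcont.eventually_mem (by simpa using hUo.mem_nhds hzU)
    obtain ⟨ε, hε, hball⟩ := Metric.eventually_nhds_iff.1 hnear
    have h1 := hside _ (hball (y := ε / 2) (by simp [abs_of_pos hε]; linarith))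
    have h2 : side (pt a) (pt b) (z - ((ε / 2 : ℝ) : ℂ) * (Complex.I * (pt b - pt a))) =
        side (pt a) (pt b) z -
        ε / 2 * (((pt b).re - (pt a).re) ^ 2 + ((pt b).im - (pt a).im) ^ 2) := by
      simp [side, Complex.mul_re, Complex.mul_im, -Complex.ofReal_div]
      ring
    rw [h2, hsz] at h1
    have := mul_pos (half_pos hε) (sq_add_sq_pos (pt_injective.ne hab))
    linarith
  have hzs : z ∈ star L := by
    by_contra hzs
    have hzW : z ∈ W := ⟨by simpa using hzlt.le, hzs⟩
    obtain ⟨y, hy1, hy2⟩ := mem_closure_iff.1 hzmem _ (hWo.connectedComponentIn (x := z))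
      (mem_connectedComponentIn hzW)
    exact hzU (by
      rw [hU, connectedComponentIn_eq hy2, ← connectedComponentIn_eq hy1]
      exact mem_connectedComponentIn hzW)
  rcases hzs with hzs | hzs
  · rw [mem_sphere_zero_iff_norm] at hzs; linarith
  simp only [Set.mem_iUnion] at hzs
  obtain ⟨l, hl, hzl⟩ := hzs
  induction l using Sym2.ind with
  | h c d =>
  have hcd : c ≠ d := by
    rintro rfl
    rw [chord_mk, segment_same, Set.mem_singleton_iff] at hzl
    rw [norm_lt_one_iff, hzl, normSq_pt] at hzlt
    linarith
  have hne : ∀ y ∈ U, side (pt c) (pt d) y ≠ 0 := by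
    intro y hy h0
    have hyW : y ∈ W := connectedComponentIn_subset _ _ hy
    have hy1 : ‖y‖ < 1 := by
      refine lt_of_le_of_ne (by simpa using hyW.1) fun h1 => hyW.2 (Or.inl (by simpa using h1))
    exact hyW.2 (Or.inr (Set.mem_biUnion hl (mem_chord_of_side_eq_zero hcd hy1 h0)))
  have hcont := continuous_side (pt c) (pt d)
  have hUc : IsPreconnected U := isPreconnected_connectedComponentIn
  have hsign : (∀ y ∈ U, 0 ≤ side (pt c) (pt d) y) ∨ (∀ y ∈ U, side (pt c) (pt d) y ≤ 0) := by
    by_contra! hcon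
    obtain ⟨⟨y, hy, hy0⟩, x, hx, hx0⟩ := hcon
    obtain ⟨w, hw, hw0⟩ := hUc.intermediate_value hy hx hcont.continuousOn ⟨hy0.le, hx0.le⟩
    exact hne w hw hw0
  have hmid : side (pt c) (pt d) (pt a) + side (pt c) (pt d) (pt b) = 0 := by
    have := side_eq_zero_of_mem_chord hzl
    rw [hz, side_comb _ _ _ _ (by ring)] at this
    linarith
  have hzero : side (pt c) (pt d) (pt a) = 0 ∧ side (pt c) (pt d) (pt b) = 0 := by
    rcases hsign with hs | hs
    · have hcl : closure U ⊆ {y | 0 ≤ side (pt c) (pt d) y} :=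
        closure_minimal hs (isClosed_le continuous_const hcont)
      have h1 : 0 ≤ side (pt c) (pt d) (pt a) := hcl hAmem
      have h2 : 0 ≤ side (pt c) (pt d) (pt b) := hcl hBmem
      constructor <;> linarith
    · have hcl : closure U ⊆ {y | side (pt c) (pt d) y ≤ 0} :=
        closure_minimal hs (isClosed_le hcont continuous_const)
      have h1 : side (pt c) (pt d) (pt a) ≤ 0 := hcl hAmem
      have h2 : side (pt c) (pt d) (pt b) ≤ 0 := hcl hBmem
      constructor <;> linarith
  rcases eq_or_eq_of_side_eq_zero hcd hzero.1 with rfl | rfl <;>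
  rcases eq_or_eq_of_side_eq_zero hcd hzero.2 with rfl | rfl
  · exact absurd rfl hab
  · exact hl
  · rw [Sym2.eq_swap]; exact hl
  · exact absurd rfl hab

lemma pt_mem_chord_left (a b : S) : pt a ∈ chord s(a, b) := by
  rw [chord_mk]; exact left_mem_segment ℝ _ _

lemma pt_mem_chord_right (a b : S) : pt b ∈ chord s(a, b) := by
  rw [chord_mk]; exact right_mem_segment ℝ _ _

lemma sigmaChord_mk (d : ℕ) (a b : S) : sigmaChord d s(a, b) = s(sigma d a, sigma d b) := rfl

/-! ### Sibling leaves and preservation of cyclic order. -/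

/-- The siblings of a leaf, with endpoints listed in matching order. -/
lemma IsSiblingInvariant.exists_siblings {L : Set (Sym2 S)} (hL : IsSiblingInvariant 3 L)
    {c p : S} (hcp : s(c, p) ∈ L) (hne : sigma 3 c ≠ sigma 3 p) :
    ∃ x y : Fin 3 → S, Function.Injective x ∧ Function.Injective y ∧ (∀ i, s(x i, y i) ∈ L) ∧
      (∀ i, sigma 3 (x i) = sigma 3 c) ∧ (∀ i, sigma 3 (y i) = sigma 3 p) ∧
      ∃ i, x i = c ∧ y i = p := by
  obtain ⟨f, ⟨i₀, hi₀⟩, hf, hdisj⟩ := hL.sibling _ hcp (by simpa [sigmaChord_mk] using hne)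
  have hxy : ∀ i, ∃ x y, f i = s(x, y) ∧ sigma 3 x = sigma 3 c ∧ sigma 3 y = sigma 3 p := by
    intro i
    have h := (hf i).2
    generalize f i = l at h
    induction l using Sym2.ind with
    | h x y =>
    rw [sigmaChord_mk, sigmaChord_mk, Sym2.eq_iff] at h
    rcases h with h | h
    · exact ⟨x, y, rfl, h⟩
    · exact ⟨y, x, Sym2.eq_swap, h.2, h.1⟩
  choose x y he hx hy using hxy
  refine ⟨x, y, fun i j hij => ?_, fun i j hij => ?_, fun i => he i ▸ (hf i).1, hx, hy, i₀, ?_⟩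
  · by_contra hne
    refine Set.disjoint_left.1 (hdisj i j hne) (show pt (x i) ∈ _ from ?_) ?_
    · rw [he]; exact pt_mem_chord_left _ _
    · rw [he, hij]; exact pt_mem_chord_left _ _
  · by_contra hne
    refine Set.disjoint_left.1 (hdisj i j hne) (show pt (y i) ∈ _ from ?_) ?_
    · rw [he]; exact pt_mem_chord_right _ _
    · rw [he, hij]; exact pt_mem_chord_right _ _
  · have h := (he i₀).symm.trans hi₀
    rcases Sym2.eq_iff.1 h with h | h
    · exact h
    · exact absurd (by rw [← hx i₀, h.1]) hne

/-- The points of a fibre are spaced by thirds, so `κ` numbers them in the order in which they are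
met from `a`. -/
lemma exists_index_of_sigma_eq (a : S) {x : Fin 3 → S} (hx : Function.Injective x) {q : S}
    (hq : ∀ i, sigma 3 (x i) = q) :
    ∃ κ : Fin 3 → ℕ, (∀ i, κ i < 3) ∧ Function.Injective κ ∧
      ∀ i, 3 * len a (x i) = len (sigma 3 a) q + κ i := by
  choose κ h1 h2 using fun i => three_mul_len a (x i)
  simp only [hq] at h2
  refine ⟨κ, h1, fun i j hij => hx (eq_of_len_eq (a := a) ?_), h2⟩
  have h3 := h2 i
  rw [hij, ← h2 j] at h3
  linarith

/-- A leaf `cp` adjacent to the leaf `ab`, with `c` outside of the arc from `a` to `b`, has the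
image of `c` outside of the arc from the image of `a` to the image of `b`. -/
lemma IsSiblingInvariant.len_le_of_adjacent {L : Set (Sym2 S)} (hL : IsSiblingInvariant 3 L)
    {a b c p : S} (hab : s(a, b) ∈ L) (hcp : s(c, p) ∈ L) (hp : p = a ∨ p = b)
    (hc : len a b < len a c) (h1 : sigma 3 a ≠ sigma 3 b) (h2 : sigma 3 c ≠ sigma 3 a)
    (h3 : sigma 3 c ≠ sigma 3 b) :
    len (sigma 3 a) (sigma 3 b) ≤ len (sigma 3 a) (sigma 3 c) := by
  by_contra! hlt
  have hcp' : sigma 3 c ≠ sigma 3 p := by rcases hp with rfl | rfl <;> assumption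
  obtain ⟨x, y, hx, hy, hxy, hxc, hyp, i₀, hxi, hyi⟩ := hL.exists_siblings hcp hcp'
  -- A sibling starting inside the arc stays inside. It cannot end at `p`, which is taken by the
  -- leaf from `c` outside, nor at the other endpoint, which has a different image.
  have hin : ∀ i, 0 < len a (x i) → len a (x i) < len a b →
      0 < len a (y i) ∧ len a (y i) < len a b := by
    intro i h4 h5
    have hyne : y i ≠ p := by
      intro h
      have : i = i₀ := hy (h.trans hyi.symm)
      rw [this, hxi] at h5
      linarith
    have hya : y i ≠ a := by
      rintro rfl
      rcases hp with rfl | rfl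
      · exact hyne rfl
      · exact h1 (hyp i)
    have hyb : y i ≠ b := by
      rintro rfl
      rcases hp with rfl | rfl
      · exact h1 (hyp i).symm
      · exact hyne rfl
    exact ⟨len_pos hya.symm, lt_of_le_of_ne (hL.toIsLamination.not_cross hab (hxy i) h4 h5)
      fun h => hyb (eq_of_len_eq h)⟩
  obtain ⟨κ, hκ, hκi, hκe⟩ := exists_index_of_sigma_eq a hx hxc
  obtain ⟨μ, hμ, hμi, hμe⟩ := exists_index_of_sigma_eq a hy hyp
  obtain ⟨w, hw, hwe⟩ := three_mul_len a b
  have hpos := len_pos h2.symm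
  have hlt1 := len_lt_one (sigma 3 a) (sigma 3 b)
  -- If `σ₃ c` lay in the image arc, the arc `ab` would contain the `w + 1` fibre points with index
  -- at most `w`. Their siblings end at distinct points over `σ₃ p` in the open arc, which holds
  -- only `w` of these: indices `1, …, w` if `p = a`, and `0, …, w - 1` if `p = b`.
  have himp : ∀ i, κ i ≤ w → 0 < len a (y i) ∧ len a (y i) < len a b := by
    intro i hi
    have : (κ i : ℝ) ≤ w := by exact_mod_cast hi
    have h0 : (0 : ℝ) ≤ κ i := by positivity
    have := hκe i
    exact hin i (by linarith) (by linarith)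
  have hκ01 : κ 0 ≠ κ 1 := hκi.ne (by decide)
  have hκ02 : κ 0 ≠ κ 2 := hκi.ne (by decide)
  have hκ12 : κ 1 ≠ κ 2 := hκi.ne (by decide)
  have hμ01 : μ 0 ≠ μ 1 := hμi.ne (by decide)
  have hμ02 : μ 0 ≠ μ 2 := hμi.ne (by decide)
  have hμ12 : μ 1 ≠ μ 2 := hμi.ne (by decide)
  have := hκ 0
  have := hκ 1
  have := hκ 2
  rcases hp with rfl | rfl
  · have himp' : ∀ i, κ i ≤ w → 0 < μ i ∧ μ i < w + 1 := by
      intro i hi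
      obtain ⟨h4, h5⟩ := himp i hi
      have h6 := hμe i
      rw [len_self] at h6
      constructor
      · have : (0 : ℝ) < μ i := by linarith
        exact_mod_cast this
      · have : (μ i : ℝ) < w + 1 := by linarith
        exact_mod_cast this
    have := himp' 0
    have := himp' 1
    have := himp' 2
    omega
  · have himp' : ∀ i, κ i ≤ w → μ i < w := by
      intro i hi
      obtain ⟨h4, h5⟩ := himp i hi
      have h6 := hμe i
      have : (μ i : ℝ) < w := by linarith
      exact_mod_cast this
    have := himp' 0
    have := himp' 1
    have := himp' 2
    omega

/-- `σ₃` preserves the cyclic order of the vertices of a quadrilateral whose edges are leaves. -/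
lemma IsSiblingInvariant.cyc_sigma {L : Set (Sym2 S)} (hL : IsSiblingInvariant 3 L)
    {a b c d : S} (h : Cyc a b c d) (hab : s(a, b) ∈ L) (hbc : s(b, c) ∈ L)
    (hcd : s(c, d) ∈ L) (hda : s(d, a) ∈ L)
    (h1 : sigma 3 a ≠ sigma 3 b) (h2 : sigma 3 a ≠ sigma 3 c) (h3 : sigma 3 a ≠ sigma 3 d)
    (h4 : sigma 3 b ≠ sigma 3 c) (h5 : sigma 3 b ≠ sigma 3 d) (h6 : sigma 3 c ≠ sigma 3 d) :
    Cyc (sigma 3 a) (sigma 3 b) (sigma 3 c) (sigma 3 d) := by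
  have h' := h.rotate
  refine cyc_of_le h1 h4 h6 ?_ ?_ ?_
  · exact hL.len_le_of_adjacent hab (Sym2.eq_swap ▸ hbc) (Or.inr rfl) h.2.1 h1 h2.symm h4.symm
  · exact hL.len_le_of_adjacent hab hda (Or.inl rfl) (h.2.1.trans h.2.2) h1 h3.symm h5.symm
  · exact hL.len_le_of_adjacent hbc (Sym2.eq_swap ▸ hcd) (Or.inr rfl) h'.2.1 h4 h5.symm h6.symm

/-! ### Cycles of quadrilaterals and their critical sectors. -/

/-- A periodic cycle of pairwise disjoint cyclically ordered quadrilaterals, with edges in `L`, whose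
vertices are mapped forward by `σ₃`. -/
structure IsQuadCycle (L : Set (Sym2 S)) (n : ℕ) (v : ℕ → Fin 4 → S) : Prop where
  pos : 0 < n
  map : ∀ i j, sigma 3 (v i j) = v (i + 1) j
  per : ∀ i j, v (i + n) j = v i j
  leaf : ∀ i j, s(v i j, v i (j + 1)) ∈ L
  cyc : ∀ i, Cyc (v i 0) (v i 1) (v i 2) (v i 3)
  inj : ∀ i j k l, v i j = v k l → i ≡ k [MOD n] ∧ j = l

lemma Cyc.len_succ_le {v : Fin 4 → S} (h : Cyc (v 0) (v 1) (v 2) (v 3)) (j k : Fin 4)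
    (hjk : k ≠ j) : len (v j) (v (j + 1)) ≤ len (v j) (v k) := by
  have h1 := h.rotate
  have h2 := h1.rotate
  have h3 := h2.rotate
  obtain ⟨-, a1, a2⟩ := h
  obtain ⟨-, b1, b2⟩ := h1
  obtain ⟨-, c1, c2⟩ := h2
  obtain ⟨-, d1, d2⟩ := h3
  fin_cases j <;> fin_cases k <;> simp at hjk ⊢ <;> linarith

namespace IsQuadCycle

variable {L : Set (Sym2 S)} {n : ℕ} {v : ℕ → Fin 4 → S}

lemma len_pos (h : IsQuadCycle L n v) (i : ℕ) (j : Fin 4) : 0 < len (v i j) (v i (j + 1)) :=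
  Lamination.len_pos fun he => by simpa using (h.inj _ _ _ _ he).2

lemma mem_sector_succ (hL : IsLamination L) (h : IsQuadCycle L n v) {i k : ℕ}
    (hik : ¬ i ≡ k [MOD n]) {j l : Fin 4} (h0 : 0 < len (v i j) (v k l))
    (h1 : len (v i j) (v k l) < len (v i j) (v i (j + 1))) :
    0 < len (v i j) (v k (l + 1)) ∧
      len (v i j) (v k (l + 1)) < len (v i j) (v i (j + 1)) := by
  refine ⟨Lamination.len_pos fun he => hik (h.inj _ _ _ _ he).1, lt_of_le_of_ne ?_ ?_⟩
  · exact hL.not_cross (h.leaf i j) (h.leaf k l) h0 h1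
  · exact fun he => hik (h.inj _ _ _ _ (eq_of_len_eq he)).1.symm

/-- Walk around the edges of the other quadrilateral: none can cross the edge that bounds the
sector. -/
lemma mem_sector (hL : IsLamination L) (h : IsQuadCycle L n v) {i k : ℕ}
    (hik : ¬ i ≡ k [MOD n]) {j l : Fin 4} (h0 : 0 < len (v i j) (v k l))
    (h1 : len (v i j) (v k l) < len (v i j) (v i (j + 1))) (m : Fin 4) :
    0 < len (v i j) (v k m) ∧ len (v i j) (v k m) < len (v i j) (v i (j + 1)) := by
  have s1 := h.mem_sector_succ hL hik h0 h1
  have s2 := h.mem_sector_succ hL hik s1.1 s1.2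
  have s3 := h.mem_sector_succ hL hik s2.1 s2.2
  obtain rfl | rfl | rfl | rfl : m = l ∨ m = l + 1 ∨ m = l + 1 + 1 ∨ m = l + 1 + 1 + 1 := by
    clear h0 h1 s1 s2 s3
    revert m l; decide
  exacts [⟨h0, h1⟩, s1, s2, s3]

/-- A sector that contains a vertex of another quadrilateral of the cycle is longer than three of
its sectors. -/
lemma exists_sector_lt (hL : IsLamination L) (h : IsQuadCycle L n v) {i k : ℕ}
    (hik : ¬ i ≡ k [MOD n]) {j l : Fin 4} (h0 : 0 < len (v i j) (v k l))
    (h1 : len (v i j) (v k l) < len (v i j) (v i (j + 1))) :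
    ∃ m₀, ∀ m, m ≠ m₀ → len (v k m) (v k (m + 1)) < len (v i j) (v i (j + 1)) := by
  have hm := h.mem_sector hL hik h0 h1
  have hstep : ∀ m, len (v k m) (v k (m + 1)) < len (v i j) (v i (j + 1)) ∨
      len (v k m) (v k (m + 1)) = len (v i j) (v k (m + 1)) - len (v i j) (v k m) + 1 := by
    intro m
    rcases len_triangle (v i j) (v k m) (v k (m + 1)) with h2 | h2
    · left; linarith [(hm m).1, (hm (m + 1)).2]
    · right; linarith
  have hsum := (h.cyc k).sum_eq
  by_contra! hcon
  -- A sector of quadrilateral `k` that is not shorter must cover the complement of the given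
  -- sector. Together with a second one of this kind it would exceed the whole circle.
  have hwrap : ∀ m, len (v i j) (v i (j + 1)) ≤ len (v k m) (v k (m + 1)) →
      1 < len (v k m) (v k (m + 1)) + len (v i j) (v i (j + 1)) := by
    intro m h2
    rcases hstep m with h3 | h3
    · linarith
    · linarith [(hm m).2, (hm (m + 1)).1]
  obtain ⟨m, -, h2⟩ := hcon 0
  obtain ⟨m', hne, h3⟩ := hcon m
  have h4 := hwrap m h2
  have p0 := h.len_pos k 0
  have p1 := h.len_pos k 1
  have p2 := h.len_pos k 2
  have p3 := h.len_pos k 3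
  have hle : len (v k m) (v k (m + 1)) + len (v k m') (v k (m' + 1)) ≤ 1 := by
    fin_cases m <;> fin_cases m' <;> simp at hne p0 p1 p2 p3 ⊢ <;> linarith
  linarith

lemma map_len (h : IsQuadCycle L n v) (i k : ℕ) (j l : Fin 4) :
    ∃ w : ℕ, w < 3 ∧ 3 * len (v i j) (v k l) = len (v (i + 1) j) (v (k + 1) l) + w := by
  simpa only [h.map] using three_mul_len (v i j) (v k l)

lemma eq_of_modEq (h : IsQuadCycle L n v) {i k : ℕ} (hik : i ≡ k [MOD n]) (j : Fin 4) :
    v i j = v k j := by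
  have hmod : ∀ i, v i j = v (i % n) j := by
    intro i
    conv_lhs => rw [← Nat.mod_add_div i n]
    induction i / n with
    | zero => simp
    | succ m ih => rw [mul_add, mul_one, ← add_assoc, h.per, ih]
  rw [hmod i, hmod k, hik]

/-- In three of the four cycles of sectors there is a sector that `σ₃` wraps around the circle at
least once, and whose image sector contains no vertices. -/
lemma exists_critical (hL : IsLamination L) (h : IsQuadCycle L n v) :
    ∃ j₀ : Fin 4, ∀ j, j ≠ j₀ → ∃ t w : ℕ, 0 < w ∧ w < 3 ∧
      3 * len (v t j) (v t (j + 1)) = len (v (t + 1) j) (v (t + 1) (j + 1)) + w ∧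
      ∀ k l, v k l ≠ v (t + 1) j →
        len (v (t + 1) j) (v (t + 1) (j + 1)) ≤ len (v (t + 1) j) (v k l) := by
  have hmin : ∀ j, ∃ s, ∀ i, len (v s j) (v s (j + 1)) ≤ len (v i j) (v i (j + 1)) := by
    intro j
    obtain ⟨s, -, hs⟩ := Finset.exists_min_image (Finset.range n)
      (fun i => len (v i j) (v i (j + 1))) ⟨0, Finset.mem_range.2 h.pos⟩
    refine ⟨s, fun i => ?_⟩
    have hi := hs (i % n) (Finset.mem_range.2 (Nat.mod_lt _ h.pos))
    rwa [h.eq_of_modEq (Nat.mod_modEq i n), h.eq_of_modEq (Nat.mod_modEq i n)] at hi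
  choose s hs using hmin
  obtain ⟨j₀, -, hj₀⟩ := Finset.exists_max_image Finset.univ
    (fun j => len (v (s j) j) (v (s j) (j + 1))) ⟨0, Finset.mem_univ _⟩
  refine ⟨j₀, fun j hj => ?_⟩
  -- The time before `s j`; adding `n` first keeps the subtraction valid when `s j = 0`.
  have ht : s j + n - 1 + 1 ≡ s j [MOD n] := by
    have := h.pos
    rw [show s j + n - 1 + 1 = s j + n by omega]
    simp
  obtain ⟨w, hw, hwe⟩ := h.map_len (s j + n - 1) (s j + n - 1) j (j + 1)
  refine ⟨s j + n - 1, w, ?_, hw, hwe, ?_⟩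
  · rcases Nat.eq_zero_or_pos w with rfl | hw0
    · have h1 := hs j (s j + n - 1)
      have h2 := h.len_pos (s j) j
      rw [h.eq_of_modEq ht, h.eq_of_modEq ht] at hwe
      push_cast at hwe
      linarith
    · exact hw0
  · rw [h.eq_of_modEq ht, h.eq_of_modEq ht]
    intro k l hne
    by_cases hk : s j ≡ k [MOD n]
    · rw [← h.eq_of_modEq hk] at hne ⊢
      refine (h.cyc (s j)).len_succ_le j l ?_
      rintro rfl
      exact hne rfl
    · by_contra! hlt
      -- The exceptional index is `j`, since `s j` is a minimum. Hence the sector of index `j₀` is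
      -- shorter than the shortest one of index `j`, against the choice of `j₀`.
      obtain ⟨m₀, hm₀⟩ := h.exists_sector_lt hL hk (Lamination.len_pos hne.symm) hlt
      have hlt' : ∀ m, m ≠ m₀ → m ≠ j ∧
          len (v (s m) m) (v (s m) (m + 1)) < len (v (s j) j) (v (s j) (j + 1)) := by
        intro m hm
        refine ⟨?_, (hs m k).trans_lt (hm₀ m hm)⟩
        rintro rfl
        exact absurd ((hs m k).trans_lt (hm₀ m hm)) (lt_irrefl _)
      have hjm : m₀ = j := by
        by_contra hne
        exact (hlt' j (Ne.symm hne)).1 rfl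
      have h1 := (hlt' j₀ (fun h => hj (h.trans hjm).symm)).2
      exact absurd (hj₀ j (Finset.mem_univ _)) (not_le.2 h1)

/-- The unlinking of two critical sectors, in terms of the positions of their first endpoints
relative to the preimages of their images. -/
lemma exists_mod_eq (hL : IsLamination L) (h : IsQuadCycle L n v) {j₁ j₂ : Fin 4}
    (hj : j₁ ≠ j₂) {t₁ t₂ w₁ w₂ : ℕ} (hw₁ : 0 < w₁) (hw₁' : w₁ < 3) (hw₂ : 0 < w₂) (hw₂' : w₂ < 3)
    (h₁ : 3 * len (v t₁ j₁) (v t₁ (j₁ + 1)) = len (v (t₁ + 1) j₁) (v (t₁ + 1) (j₁ + 1)) + w₁)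
    (h₂ : 3 * len (v t₂ j₂) (v t₂ (j₂ + 1)) = len (v (t₂ + 1) j₂) (v (t₂ + 1) (j₂ + 1)) + w₂)
    (e₁ : ∀ k l, v k l ≠ v (t₁ + 1) j₁ →
      len (v (t₁ + 1) j₁) (v (t₁ + 1) (j₁ + 1)) ≤ len (v (t₁ + 1) j₁) (v k l))
    (e₂ : ∀ k l, v k l ≠ v (t₂ + 1) j₂ →
      len (v (t₂ + 1) j₂) (v (t₂ + 1) (j₂ + 1)) ≤ len (v (t₂ + 1) j₂) (v k l)) :
    ∃ k : ℕ, 3 * len (v t₁ j₁) (v t₂ j₂) = len (v (t₁ + 1) j₁) (v (t₂ + 1) j₂) + k ∧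
      (k + 2 * (w₂ - 1) + 4 * (w₁ - 1)) % 3 = 1 := by
  -- With the image sector shrunk to a point, the edge joins points `w / 3` apart. Moving its first
  -- endpoint by `2 * (w - 1) / 3` makes the step `1 / 3` for both values of `w`. This changes `k`
  -- by `2 * (w₂ - 1) - 2 * (w₁ - 1)`, where `-2` is written as `4` modulo 3; the claim is that the
  -- second chord then starts in the middle third.
  obtain ⟨k, hk, hke⟩ := h.map_len t₁ t₂ j₁ j₂
  refine ⟨k, hke, ?_⟩
  have hne : v (t₂ + 1) j₂ ≠ v (t₁ + 1) j₁ := fun he => hj (h.inj _ _ _ _ he).2.symm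
  have hq₁ := e₁ _ _ hne
  have hq₂ := e₂ _ _ hne.symm
  have hq := len_add_len hne
  have hs₁ := h.len_pos (t₁ + 1) j₁
  have hs₂ := h.len_pos (t₂ + 1) j₂
  -- The strict lower bound on the right matters for two sectors of one quadrilateral, where the
  -- second may end at the start of the first.
  have hlink : len (v t₁ j₁) (v t₂ j₂) < len (v t₁ j₁) (v t₁ (j₁ + 1)) ↔
      0 < len (v t₁ j₁) (v t₂ (j₂ + 1)) ∧
        len (v t₁ j₁) (v t₂ (j₂ + 1)) < len (v t₁ j₁) (v t₁ (j₁ + 1)) := by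
    by_cases ht : t₁ ≡ t₂ [MOD n]
    · have hc := (h.cyc t₁).len_succ_le
      rw [← h.eq_of_modEq ht, ← h.eq_of_modEq ht]
      constructor
      · intro h3
        exact absurd (hc j₁ j₂ hj.symm) (not_le.2 h3)
      · rintro ⟨h3, h4⟩
        refine absurd (hc j₁ (j₂ + 1) ?_) (not_le.2 h4)
        intro he
        rw [he, len_self] at h3
        exact lt_irrefl _ h3
    · have h3 : 0 < len (v t₁ j₁) (v t₂ j₂) :=
        Lamination.len_pos fun he => ht (h.inj _ _ _ _ he).1
      exact ⟨fun h4 => h.mem_sector hL ht h3 h4 _, fun h4 => (h.mem_sector hL ht h4.1 h4.2 _).2⟩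
  have htri := len_triangle (v t₁ j₁) (v t₂ j₂) (v t₂ (j₂ + 1))
  have hb0 := len_nonneg (v t₁ j₁) (v t₂ (j₂ + 1))
  have hb1 := len_lt_one (v t₁ j₁) (v t₂ (j₂ + 1))
  generalize len (v t₁ j₁) (v t₂ j₂) = p at *
  generalize len (v t₁ j₁) (v t₁ (j₁ + 1)) = T₁ at *
  generalize len (v t₂ j₂) (v t₂ (j₂ + 1)) = T₂ at *
  generalize len (v t₁ j₁) (v t₂ (j₂ + 1)) = b at *
  generalize len (v (t₁ + 1) j₁) (v (t₁ + 1) (j₁ + 1)) = s₁ at *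
  generalize len (v (t₂ + 1) j₂) (v (t₂ + 1) (j₂ + 1)) = s₂ at *
  generalize len (v (t₁ + 1) j₁) (v (t₂ + 1) j₂) = q at *
  generalize len (v (t₂ + 1) j₂) (v (t₁ + 1) j₁) = q' at *
  by_contra hcon
  interval_cases w₁ <;> interval_cases w₂ <;> interval_cases k <;> simp at hcon h₁ h₂ hke <;>
  first
  | (have h5 : p < T₁ := by linarith
     have h6 := hlink.1 h5
     rcases htri with h7 | h7 <;> linarith)
  | (have h5 : 0 < b ∧ b < T₁ := by
       rcases htri with h7 | h7 <;> constructor <;> linarith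
     linarith [hlink.2 h5])

/-- Normalized as in `exists_mod_eq`, all three relative positions are 1 modulo 3. Adding arcs gives
`1 + 1 + δ ≡ 1` modulo 3, where `δ` is 0 or 1 according to whether the image arcs pass a full turn;
this is impossible. -/
theorem false (hL : IsLamination L) (h : IsQuadCycle L n v) : False := by
  obtain ⟨j₀, hj₀⟩ := h.exists_critical hL
  obtain ⟨n1, n2, n3, n12, n23, n13⟩ : j₀ + 1 ≠ j₀ ∧ j₀ + 2 ≠ j₀ ∧ j₀ + 3 ≠ j₀ ∧
      j₀ + 1 ≠ j₀ + 2 ∧ j₀ + 2 ≠ j₀ + 3 ∧ j₀ + 1 ≠ j₀ + 3 := by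
    clear hj₀
    revert j₀; decide
  obtain ⟨t₁, w₁, p₁, l₁, h₁, e₁⟩ := hj₀ (j₀ + 1) n1
  obtain ⟨t₂, w₂, p₂, l₂, h₂, e₂⟩ := hj₀ (j₀ + 2) n2
  obtain ⟨t₃, w₃, p₃, l₃, h₃, e₃⟩ := hj₀ (j₀ + 3) n3
  obtain ⟨k, hk, hkm⟩ := h.exists_mod_eq hL n12 p₁ l₁ p₂ l₂ h₁ h₂ e₁ e₂
  obtain ⟨k', hk', hkm'⟩ := h.exists_mod_eq hL n23 p₂ l₂ p₃ l₃ h₂ h₃ e₂ e₃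
  obtain ⟨k'', hk'', hkm''⟩ := h.exists_mod_eq hL n13 p₁ l₁ p₃ l₃ h₁ h₃ e₁ e₃
  rcases len_triangle (v t₁ (j₀ + 1)) (v t₂ (j₀ + 2)) (v t₃ (j₀ + 3)) with ht | ht <;>
  rcases len_triangle (v (t₁ + 1) (j₀ + 1)) (v (t₂ + 1) (j₀ + 2)) (v (t₃ + 1) (j₀ + 3))
    with hs | hs
  · have : (k'' : ℝ) = k + k' := by linarith
    norm_cast at this; omega
  · have : (k'' : ℝ) = k + k' + 1 := by linarith
    norm_cast at this; omega
  · have : (k'' : ℝ) + 3 = k + k' := by linarith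
    norm_cast at this; omega
  · have : (k'' : ℝ) + 2 = k + k' := by linarith
    norm_cast at this; omega

end IsQuadCycle

/-! ### From an identity return quadrilateral to a cycle. -/

theorem IsSiblingInvariant.exists_isQuadCycle {L : Set (Sym2 S)} (hL : IsSiblingInvariant 3 L)
    {V : Finset S} (hV : V.card = 4) (hP : IsIdentityReturnPolygon 3 L V) :
    ∃ n v, IsQuadCycle L n v := by
  obtain ⟨hpoly, n, hn, hdisj, hret⟩ := hP
  obtain ⟨u, huV, hVu, hinj, hcyc⟩ := exists_cyc hV
  have hper : ∀ i j, (sigma 3)^[i + n] (u j) = (sigma 3)^[i] (u j) := fun i j => by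
    rw [Function.iterate_add_apply, hret _ (huV j)]
  have hmod : ∀ i j, (sigma 3)^[i] (u j) = (sigma 3)^[i % n] (u j) := by
    intro i j
    conv_lhs => rw [← Nat.mod_add_div i n]
    induction i / n with
    | zero => simp
    | succ m ih => rw [mul_add, mul_one, ← add_assoc, hper, ih]
  have hvinj : ∀ i j k l, (sigma 3)^[i] (u j) = (sigma 3)^[k] (u l) →
      i ≡ k [MOD n] ∧ j = l := by
    intro i j k l he
    rw [hmod i, hmod k] at he
    have hi := Nat.mod_lt i hn
    have hik : i % n = k % n := by
      by_contra hne
      have h1 : pt ((sigma 3)^[i % n] (u j)) ∈ hull ((sigma 3)^[i % n] '' (V : Set S)) :=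
        subset_convexHull ℝ _ ⟨_, ⟨u j, huV j, rfl⟩, rfl⟩
      have h2 : pt ((sigma 3)^[i % n] (u j)) ∈ hull ((sigma 3)^[k % n] '' (V : Set S)) :=
        subset_convexHull ℝ _ ⟨_, ⟨u l, huV l, rfl⟩, congrArg pt he.symm⟩
      exact Set.disjoint_left.1 (hdisj _ hi _ (Nat.mod_lt k hn) hne) h1 h2
    refine ⟨hik, hinj ?_⟩
    rw [← hik] at he
    -- Completing the period returns both points to time 0, where the vertices are distinct.
    have := congrArg (sigma 3)^[n - i % n] he
    rwa [← Function.iterate_add_apply, ← Function.iterate_add_apply, Nat.sub_add_cancel hi.le,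
      hret _ (huV j), hret _ (huV l)] at this
  have hleaf : ∀ i j, s((sigma 3)^[i] (u j), (sigma 3)^[i] (u (j + 1))) ∈ L := by
    intro i
    induction i with
    | zero =>
      intro j
      refine hL.toIsLamination.leaf_of_isGap hpoly (huV j) (huV (j + 1)) (fun he => ?_) ?_
      · simpa using hinj he
      · intro x hx
        obtain ⟨k, rfl⟩ := hVu x hx
        by_cases hk : k = j
        · exact Or.inl (congrArg u hk)
        · exact Or.inr (hcyc.len_succ_le j k hk)
    | succ i ih =>
      intro j
      rw [Function.iterate_succ_apply', Function.iterate_succ_apply', ← sigmaChord_mk]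
      exact hL.forward _ (ih j)
  refine ⟨n, fun i j => (sigma 3)^[i] (u j), hn, fun i j => (Function.iterate_succ_apply' _ _ _).symm,
    hper, hleaf, fun i => ?_, hvinj⟩
  induction i with
  | zero => exact hcyc
  | succ i ih =>
    have hne : ∀ j l : Fin 4, j ≠ l →
        sigma 3 ((sigma 3)^[i] (u j)) ≠ sigma 3 ((sigma 3)^[i] (u l)) := by
      intro j l hjl he
      rw [← Function.iterate_succ_apply' (sigma 3), ← Function.iterate_succ_apply' (sigma 3)] at he
      exact hjl (hvinj _ _ _ _ he).2
    simp only [Function.iterate_succ_apply']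
    exact hL.cyc_sigma ih (hleaf i 0) (hleaf i 1) (hleaf i 2) (hleaf i 3)
      (hne _ _ (by decide)) (hne _ _ (by decide)) (hne _ _ (by decide))
      (hne _ _ (by decide)) (hne _ _ (by decide)) (hne _ _ (by decide))

end Lamination

theorem theorem4p9 (L : Set (Sym2 Lamination.S)) (hL : Lamination.IsSiblingInvariant 3 L) :
    ¬ ∃ V : Finset Lamination.S, V.card = 4 ∧ Lamination.IsIdentityReturnPolygon 3 L V := by
  rintro ⟨V, hV, hP⟩
  obtain ⟨n, v, hv⟩ := hL.exists_isQuadCycle hV hP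
  exact hv.false hL.toIsLamination
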